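/- Let $K$ be a field of characteristic $0$ and let $y_i\in K$, $i\in\mathbb Z$, be nonzero elements; for instance, the $y_i$ may be independent formal parameters and $K=\mathbb C(\dots,y_{-1},y_0,y_1,\dots)$. Let $p=(p_1,p_2,\dots)$ and $q=(q_1,q_2,\dots)$ be two sequences of independent variables. Define $s_k$, $k\in\mathbb Z$, by $\sum_{k\ge0}s_k(p)z^k=\exp\bigl(\sum_{i\ge1}p_iz^i/i\bigr)$ and $s_k=0$ for $k<0$, and for a partition $\mu$ of length $\ell$ let $s_\mu=\det\|s_{\mu_j-j+i}\|_{1\le i,j\le \ell}$ be the Schur polynomial. For $n\in\mathbb Z$ set $$\tau_n(p;q)=r_0(n)\sum_\mu r_\mu(n)\,s_\mu(p)\,s_\mu(q),\qquad r_\mu(n)=\prod_{w\in\mu}y_{c(w)+n},$$ $$r_0(n)=\prod_{j=1}^{n-1}y_j^{\,n-j}\ \ (n\ge0),\qquad r_0(n)=\prod_{j=n+1}^{0}y_j^{\,j-n}\ \ (n<0),$$ where the sum is over all partitions $\mu$, and $c(w)=j-i$ is the content of the cell $w$ in row $i$ and column $j$ of the Young diagram of $\mu$. For $n\in\mathbb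 Z$ and formal Laurent series $\beta_1,\beta_2,\dots$ in $z$ such that $\beta_k=z^{n-k}+(\text{higher powers of }z)$ for all large $k$, write $\beta_1\wedge\beta_2\wedge\cdots=\sum_\mu c_\mu v_\mu$, where $v_\mu=z^{\mu_1-1+n}\wedge z^{\mu_2-2+n}\wedge\cdots$; here $c_\mu$ is the determinant formed by the coefficients of $z^{\mu_i-i+n}$, $1\le i\le N$, in $\beta_1,\dots,\beta_N$, which does not depend on $N$ for $N$ large. The boson--fermion correspondence takes $\sum_\mu c_\mu v_\mu$ to the series $\sum_\mu c_\mu s_\mu(p)$. A $\tau$-function of the KP hierarchy in the variables $p$ is a nonzero series which corresponds to a decomposable vector $\beta_1\wedge\beta_2\wedge\cdots$ with $n=0$, that is, to a point of the semi-infinite Grassmannian. **Theorem.** (1) For each $n\in\mathbb Z$, the series $\tau_n$ is a $\tau$-function of the KP hierarchy in the variables $p$ (with coefficients in $K[[q]]$), and also in the variables $q$ (with coefficients in $K[[p]]$). (2) The functions $\tau_n$, $n\in\mathbb Z$, form a sequence of $\tau$-functions of the Toda lattice hierarchy attached to an upper triangular matrix: there is a matrix $M=(M_{i,k})_{i,k\in\mathbb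 Z}$ over $K$ with $M_{i,k}=0$ for $i<k$ and $M_{k,k}\ne0$, acting on Laurent series by $z^k\mapsto\sum_{i\ge k}M_{i,k}z^i$, such that for every $n\in\mathbb Z$ the boson--fermion correspondence in the variables $p$ takes $$R_n\cdot\frac{M(\beta_1)}{M_{n-1,n-1}}\wedge\frac{M(\beta_2)}{M_{n-2,n-2}}\wedge\cdots,\qquad \beta_k=\exp\Bigl(\sum_{i\ge1}\frac{q_iz^i}{i}\Bigr)z^{n-k},$$ to $\tau_n$, where $R_n=\prod_{j=0}^{n-1}M_{j,j}$ for $n\ge0$ and $R_n=\prod_{j=n}^{-1}M_{j,j}^{-1}$ for $n<0$. -/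

import Mathlib

/-- The power series `∑_{i ≥ 1} p_i z^i / i` in `z`. -/
noncomputable def powerSumSeries (R : Type*) [CommRing R] [Algebra ℚ R] :
    PowerSeries (MvPolynomial ℕ+ R) :=
  PowerSeries.mk fun i : ℕ =>
    if h : 0 < i then
      MvPolynomial.C (algebraMap ℚ R (1 / (i : ℚ))) * MvPolynomial.X (Nat.toPNat i h)
    else 0

/-- The generating series `∑ s_k z^k = exp (∑_{i ≥ 1} p_i z^i / i)` of the one-part Schur
polynomials, a power series in `z` whose coefficients are polynomials in the `p_i`, `i ≥ 1`. -/
noncomputable def onePartSchurSeries (R : Type*) [CommRing R] [Algebra ℚ R] :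
    PowerSeries (MvPolynomial ℕ+ R) :=
  (PowerSeries.exp (MvPolynomial ℕ+ R)).subst (powerSumSeries R)

/-- The polynomial `s_k` for an integer `k`; it is zero for `k < 0`. -/
noncomputable def onePartSchur (R : Type*) [CommRing R] [Algebra ℚ R] (k : ℤ) :
    MvPolynomial ℕ+ R :=
  if 0 ≤ k then PowerSeries.coeff k.toNat (onePartSchurSeries R) else 0

/-- The Schur polynomial `s_μ = det ‖s_{μ_j - j + i}‖`, `1 ≤ i, j ≤ ℓ(μ)`, in the power sum
variables `p_1, p_2, …`. The rows of a Young diagram are numbered from `0` here, which does not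
affect the difference `i - j`. -/
noncomputable def schurPoly (R : Type*) [CommRing R] [Algebra ℚ R] (μ : YoungDiagram) :
    MvPolynomial ℕ+ R :=
  Matrix.det (Matrix.of fun i j : Fin (μ.colLen 0) =>
    onePartSchur R ((μ.rowLen j : ℤ) - (j : ℕ) + (i : ℕ)))

theorem isWeightedHomogeneous_coeff_onePartSchurSeries (R : Type*) [CommRing R] [Algebra ℚ R]
    (k : ℕ) : MvPolynomial.IsWeightedHomogeneous (fun i : ℕ+ => (i : ℕ))
      (PowerSeries.coeff k (onePartSchurSeries R)) k := by
  set g := powerSumSeries R with hg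
  have hg1 : ∀ i : ℕ, MvPolynomial.IsWeightedHomogeneous (fun i : ℕ+ => (i : ℕ))
      (PowerSeries.coeff i g) i := by
    intro i
    rw [hg, powerSumSeries, PowerSeries.coeff_mk]
    split_ifs with h
    · exact (MvPolynomial.isWeightedHomogeneous_X R (fun i : ℕ+ => (i : ℕ)) (Nat.toPNat i h)).C_mul _
    · exact MvPolynomial.isWeightedHomogeneous_zero _ _ _
  have hpow : ∀ d i : ℕ, MvPolynomial.IsWeightedHomogeneous (fun i : ℕ+ => (i : ℕ))
      (PowerSeries.coeff i (g ^ d)) i := by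
    intro d
    induction d with
    | zero =>
      intro i
      rw [pow_zero, PowerSeries.coeff_one]
      split_ifs with h
      · rw [h]; exact MvPolynomial.isWeightedHomogeneous_one _ _
      · exact MvPolynomial.isWeightedHomogeneous_zero _ _ _
    | succ d ih =>
      intro i
      rw [pow_succ, PowerSeries.coeff_mul]
      refine MvPolynomial.IsWeightedHomogeneous.sum _ _ _ fun x hx => ?_
      have := (ih x.1).mul (hg1 x.2)
      rwa [Finset.HasAntidiagonal.mem_antidiagonal.mp hx] at this
  have hs : PowerSeries.HasSubst g := PowerSeries.HasSubst.of_constantCoeff_zero (by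
    have h0 : PowerSeries.coeff 0 g = 0 := by
      rw [hg, powerSumSeries, PowerSeries.coeff_mk]; simp
    rwa [PowerSeries.coeff_zero_eq_constantCoeff_apply] at h0)
  change MvPolynomial.IsWeightedHomogeneous _
    (PowerSeries.coeff k ((PowerSeries.exp (MvPolynomial ℕ+ R)).subst g)) k
  rw [PowerSeries.coeff_subst' hs]
  rw [← MvPolynomial.mem_weightedHomogeneousSubmodule]
  refine finsum_induction
    (fun x => x ∈ MvPolynomial.weightedHomogeneousSubmodule R (fun i : ℕ+ => (i : ℕ)) k)
    (Submodule.zero_mem _) (fun _ _ h1 h2 => Submodule.add_mem _ h1 h2) fun d => ?_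
  rw [MvPolynomial.mem_weightedHomogeneousSubmodule, PowerSeries.coeff_exp, smul_eq_mul,
    MvPolynomial.algebraMap_apply]
  exact (hpow d k).C_mul _

theorem youngDiagram_card_eq_sum (μ : YoungDiagram) :
    μ.card = ∑ j : Fin (μ.colLen 0), μ.rowLen j := by
  rw [Fin.sum_univ_eq_sum_range (fun j => μ.rowLen j)]
  rw [YoungDiagram.card, Finset.card_eq_sum_card_fiberwise (f := Prod.fst)
    (t := Finset.range (μ.colLen 0))]
  · refine Finset.sum_congr rfl fun i _ => ?_
    rw [YoungDiagram.rowLen_eq_card, YoungDiagram.row]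
  · intro x hx
    rw [Finset.coe_range, Set.mem_Iio, ← YoungDiagram.mem_iff_lt_colLen]
    exact μ.up_left_mem le_rfl (Nat.zero_le _) ((YoungDiagram.mem_cells x).mp hx)

/-- The Schur polynomial `s_μ` is quasihomogeneous of degree `|μ|`, where `p_i` has degree `i`. -/
theorem isWeightedHomogeneous_schurPoly (R : Type*) [CommRing R] [Algebra ℚ R]
    (μ : YoungDiagram) : MvPolynomial.IsWeightedHomogeneous (fun i : ℕ+ => (i : ℕ))
      (schurPoly R μ) μ.card := by
  rw [schurPoly, Matrix.det_apply']
  refine MvPolynomial.IsWeightedHomogeneous.sum _ _ _ fun σ _ => ?_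
  rw [show (((Equiv.Perm.sign σ : ℤˣ) : ℤ) : MvPolynomial ℕ+ R) =
    MvPolynomial.C (((Equiv.Perm.sign σ : ℤˣ) : ℤ) : R) by simp]
  refine MvPolynomial.IsWeightedHomogeneous.C_mul ?_ _
  simp only [Matrix.of_apply]
  by_cases h : ∀ j : Fin (μ.colLen 0), 0 ≤ (μ.rowLen j : ℤ) - (j : ℕ) + (σ j : ℕ)
  · have h1 := MvPolynomial.IsWeightedHomogeneous.prod (R := R) (w := fun i : ℕ+ => (i : ℕ))
      Finset.univ
      (fun j : Fin (μ.colLen 0) => onePartSchur R ((μ.rowLen j : ℤ) - (j : ℕ) + (σ j : ℕ)))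
      (fun j => ((μ.rowLen j : ℤ) - (j : ℕ) + (σ j : ℕ)).toNat) (fun j _ => by
        rw [onePartSchur, if_pos (h j)]
        exact isWeightedHomogeneous_coeff_onePartSchurSeries R _)
    have h2 : ∑ j : Fin (μ.colLen 0), ((μ.rowLen j : ℤ) - (j : ℕ) + (σ j : ℕ)).toNat =
        μ.card := by
      rw [youngDiagram_card_eq_sum]
      zify
      rw [Finset.sum_congr rfl fun j _ => Int.toNat_of_nonneg (h j), Finset.sum_add_distrib,
        Finset.sum_sub_distrib, Equiv.sum_comp σ (fun j => ((j : ℕ) : ℤ))]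
      ring
    rwa [h2] at h1
  · push Not at h
    obtain ⟨j, hj⟩ := h
    rw [Finset.prod_eq_zero (Finset.mem_univ j)]
    · exact MvPolynomial.isWeightedHomogeneous_zero _ _ _
    · rw [onePartSchur, if_neg (not_le.mpr hj)]

theorem finite_youngDiagram_card (d : ℕ) : {μ : YoungDiagram | μ.card ≤ d}.Finite := by
  refine Set.Finite.of_injOn (f := YoungDiagram.cells)
    (t := ((Finset.range d ×ˢ Finset.range d).powerset : Set (Finset (ℕ × ℕ)))) ?_
    (fun μ _ ν _ h => YoungDiagram.ext h) (Finset.finite_toSet _)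
  intro μ hμ
  rw [Finset.mem_coe, Finset.mem_powerset]
  intro x hx
  have hx' : (x.1, x.2) ∈ μ := (YoungDiagram.mem_cells x).mp hx
  have h1 : x.1 < μ.colLen x.2 := YoungDiagram.mem_iff_lt_colLen.mp hx'
  have h2 : x.2 < μ.rowLen x.1 := YoungDiagram.mem_iff_lt_rowLen.mp hx'
  have h3 : μ.colLen x.2 ≤ μ.card := by
    rw [YoungDiagram.colLen_eq_card]; exact Finset.card_le_card (Finset.filter_subset _ _)
  have h4 : μ.rowLen x.1 ≤ μ.card := by
    rw [YoungDiagram.rowLen_eq_card]; exact Finset.card_le_card (Finset.filter_subset _ _)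
  have h5 : μ.card ≤ d := hμ
  rw [Finset.mem_product, Finset.mem_range, Finset.mem_range]
  omega

/-- Every monomial occurs in finitely many terms of `∑_μ c_μ s_μ(p)`. -/
theorem finite_schur_terms {R : Type*} [CommRing R] [Algebra ℚ R] (c : YoungDiagram → R)
    (e : ℕ+ →₀ ℕ) :
    {μ | MvPowerSeries.coeff e
      (MvPowerSeries.C (c μ) * (schurPoly R μ : MvPowerSeries ℕ+ R)) ≠ 0}.Finite := by
  refine (finite_youngDiagram_card (Finsupp.weight (fun i : ℕ+ => (i : ℕ)) e)).subset ?_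
  intro μ hμ
  rw [Set.mem_ofPred_eq, MvPowerSeries.coeff_C_mul, MvPolynomial.coeff_coe] at hμ
  exact (isWeightedHomogeneous_schurPoly R μ (right_ne_zero_of_mul hμ)).ge

theorem isWeightedHomogeneous_rename {σ τ R : Type*} [CommRing R] (f : σ → τ) (w : τ → ℕ)
    {φ : MvPolynomial σ R} {n : ℕ}
    (h : MvPolynomial.IsWeightedHomogeneous (fun i => w (f i)) φ n) :
    MvPolynomial.IsWeightedHomogeneous w (MvPolynomial.rename f φ) n := by
  intro d hd
  obtain ⟨u, rfl, hu⟩ := MvPolynomial.coeff_rename_ne_zero f φ d hd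
  rw [← h hu, Finsupp.weight_apply, Finsupp.weight_apply,
    Finsupp.sum_mapDomain_index (by simp) (by intros; simp [add_mul])]

/-- Every monomial occurs in finitely many terms of `∑_μ a_μ s_μ(p) s_μ(q)`. -/
theorem finite_schur_pair_terms {R : Type*} [CommRing R] [Algebra ℚ R] (a : YoungDiagram → R)
    (e : ℕ+ ⊕ ℕ+ →₀ ℕ) :
    {μ | MvPowerSeries.coeff e (MvPowerSeries.C (a μ) *
      ((MvPolynomial.rename Sum.inl (schurPoly R μ) : MvPolynomial (ℕ+ ⊕ ℕ+) R) :
        MvPowerSeries (ℕ+ ⊕ ℕ+) R) *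
      ((MvPolynomial.rename Sum.inr (schurPoly R μ) : MvPolynomial (ℕ+ ⊕ ℕ+) R) :
        MvPowerSeries (ℕ+ ⊕ ℕ+) R)) ≠ 0}.Finite := by
  set w : ℕ+ ⊕ ℕ+ → ℕ := Sum.elim (fun i => (i : ℕ)) (fun i => (i : ℕ)) with hw
  refine (finite_youngDiagram_card (Finsupp.weight w e)).subset ?_
  intro μ hμ
  rw [Set.mem_ofPred_eq, mul_assoc, MvPowerSeries.coeff_C_mul, ← MvPolynomial.coe_mul,
    MvPolynomial.coeff_coe] at hμ
  have h1 := isWeightedHomogeneous_rename Sum.inl w (isWeightedHomogeneous_schurPoly R μ)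
  have h2 := isWeightedHomogeneous_rename Sum.inr w (isWeightedHomogeneous_schurPoly R μ)
  have h3 := (h1.mul h2) (right_ne_zero_of_mul hμ)
  rw [Set.mem_ofPred_eq, h3]
  omega

/-- The sum over all partitions of a family of power series, taken coefficient by coefficient.
It is used for families in which every monomial occurs in finitely many terms only
(see `finite_schur_terms` and `finite_schur_pair_terms`). -/
noncomputable def partitionSum {σ R : Type*} [CommRing R]
    (f : YoungDiagram → MvPowerSeries σ R) : MvPowerSeries σ R :=
  fun e => ∑ᶠ μ : YoungDiagram, MvPowerSeries.coeff e (f μ)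

/-- The bosonic image `∑_μ c_μ s_μ(p)` of the fermion `∑_μ c_μ v_μ`. -/
noncomputable def bosonSeries {R : Type*} [CommRing R] [Algebra ℚ R] (c : YoungDiagram → R) :
    MvPowerSeries ℕ+ R :=
  partitionSum fun μ => MvPowerSeries.C (c μ) * (schurPoly R μ : MvPowerSeries ℕ+ R)

/-- `β_1 ∧ β_2 ∧ ⋯` is a well defined fermion of charge `n`: for all large `k` the series `β_k`
has the form `z^{n-k} + (terms of higher degree)`. Here `β_k` is `β (k - 1)`. -/
def IsAdmissible {R : Type*} [CommRing R] (n : ℤ) (β : ℕ → LaurentSeries R) : Prop :=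
  ∀ᶠ j : ℕ in Filter.atTop,
    (β j).coeff (n - (j + 1)) = 1 ∧ ∀ m : ℤ, m < n - (j + 1) → (β j).coeff m = 0

/-- `β_1 ∧ β_2 ∧ ⋯ = ∑_μ c_μ v_μ` in the space of fermions of charge `n`, where
`v_μ = z^{m_1} ∧ z^{m_2} ∧ ⋯` with `m_i = μ_i - i + n`: the coordinate `c_μ` is the eventually
constant value of the `N × N` minors formed by the coefficients of `z^{m_1}, …, z^{m_N}` in
`β_1, …, β_N`. -/
def IsWedge {R : Type*} [CommRing R] (n : ℤ) (β : ℕ → LaurentSeries R)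
    (c : YoungDiagram → R) : Prop :=
  IsAdmissible n β ∧ ∀ μ : YoungDiagram, ∀ᶠ N : ℕ in Filter.atTop,
    Matrix.det (Matrix.of fun i j : Fin N =>
      (β j).coeff ((μ.rowLen i : ℤ) - ((i : ℕ) + 1) + n)) = c μ

/-- `τ` is a `τ`-function of the KP hierarchy in the variables `p_1, p_2, …` with coefficients in
`R`: it is nonzero and it is the bosonic image of a decomposable fermion `β_1 ∧ β_2 ∧ ⋯` (of
charge zero), that is, of a point of the semi-infinite Grassmannian. Points are considered up to a
factor; it is absorbed in `β_1`. -/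
def IsKPTau {R : Type*} [CommRing R] [Algebra ℚ R] (τ : MvPowerSeries ℕ+ R) : Prop :=
  τ ≠ 0 ∧ ∃ (β : ℕ → LaurentSeries R) (c : YoungDiagram → R),
    IsWedge 0 β c ∧ τ = bosonSeries c

/-- `r_μ(n) = ∏_{w ∈ μ} y_{c(w) + n}`, where the cell `w` in row `i` and column `j` has content
`c(w) = j - i`. -/
def contentProd {K : Type*} [Field K] (y : ℤ → K) (μ : YoungDiagram) (n : ℤ) : K :=
  ∏ w ∈ μ.cells, y ((w.2 : ℤ) - (w.1 : ℤ) + n)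

/-- `r_0(n) = ∏_{j=1}^{n-1} y_j^{n-j}` for `n ≥ 0`, and `r_0(n) = ∏_{j=n+1}^{0} y_j^{j-n}` for
`n < 0`. -/
noncomputable def normFactor {K : Type*} [Field K] (y : ℤ → K) (n : ℤ) : K :=
  if 0 ≤ n then ∏ j ∈ Finset.Icc 1 (n - 1), y j ^ (n - j).toNat
  else ∏ j ∈ Finset.Icc (n + 1) 0, y j ^ (j - n).toNat

/-- `τ_n(p; q) = r_0(n) ∑_μ r_μ(n) s_μ(p) s_μ(q)`. The variable `p_i` is indexed by `Sum.inl i` and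
the variable `q_i` by `Sum.inr i`. -/
noncomputable def contentTau {K : Type*} [Field K] [CharZero K] (y : ℤ → K) (n : ℤ) :
    MvPowerSeries (ℕ+ ⊕ ℕ+) K :=
  MvPowerSeries.C (normFactor y n) * partitionSum fun μ =>
    MvPowerSeries.C (contentProd y μ n) *
      ((MvPolynomial.rename Sum.inl (schurPoly K μ) : MvPolynomial (ℕ+ ⊕ ℕ+) K) :
        MvPowerSeries (ℕ+ ⊕ ℕ+) K) *
      ((MvPolynomial.rename Sum.inr (schurPoly K μ) : MvPolynomial (ℕ+ ⊕ ℕ+) K) :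
        MvPowerSeries (ℕ+ ⊕ ℕ+) K)

/-- A power series in `p` and `q`, regarded as a power series in `p` whose coefficients are power
series in `q`. -/
noncomputable def asSeriesInP {K : Type*} [Field K] (F : MvPowerSeries (ℕ+ ⊕ ℕ+) K) :
    MvPowerSeries ℕ+ (MvPowerSeries ℕ+ K) :=
  fun a b => MvPowerSeries.coeff (Finsupp.sumElim a b) F

/-- A power series in `p` and `q`, regarded as a power series in `q` whose coefficients are power
series in `p`. -/
noncomputable def asSeriesInQ {K : Type*} [Field K] (F : MvPowerSeries (ℕ+ ⊕ ℕ+) K) :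
    MvPowerSeries ℕ+ (MvPowerSeries ℕ+ K) :=
  fun b a => MvPowerSeries.coeff (Finsupp.sumElim a b) F

/-- The action `z^k ↦ ∑_{i ≥ k} M_{i,k} z^i` of an upper triangular `ℤ × ℤ` matrix on Laurent
series; the coefficient of `z^i` in the image of `∑_k f_k z^k` is the finite sum
`∑_{k ≤ i} M_{i,k} f_k`. -/
noncomputable def upperAct {R : Type*} [CommRing R] (M : ℤ → ℤ → R) (f : LaurentSeries R) :
    LaurentSeries R :=
  HahnSeries.ofSuppBddBelow
    (fun i : ℤ => ∑ k ∈ Finset.Icc f.order i, M i k * f.coeff k)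
    ⟨f.order, fun i hi => by
      by_contra h
      exact hi (by simp [Finset.Icc_eq_empty h])⟩

/-- The Laurent series `β_k = exp (∑_i q_i z^i / i) z^{n-k}`, with coefficients in the ring of
power series in `q`. -/
noncomputable def todaBeta (K : Type*) [Field K] [CharZero K] (n k : ℤ) :
    LaurentSeries (MvPowerSeries ℕ+ K) :=
  HahnSeries.single (n - k) 1 *
    HahnSeries.ofPowerSeries ℤ (MvPowerSeries ℕ+ K)
      (PowerSeries.map MvPolynomial.coeToMvPowerSeries.ringHom (onePartSchurSeries K))

/-- The factor `∏_{j=0}^{n-1} M_{j,j}` for `n ≥ 0`, and `∏_{j=n}^{-1} M_{j,j}^{-1}` for `n < 0`. -/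
noncomputable def diagFactor {K : Type*} [Field K] (M : ℤ → ℤ → K) (n : ℤ) : K :=
  if 0 ≤ n then ∏ j ∈ Finset.Ico 0 n, M j j else ∏ j ∈ Finset.Ico n 0, (M j j)⁻¹

/-- The sequence `τ_n`, `n ∈ ℤ`, is the sequence of `τ`-functions of the Toda lattice hierarchy
attached to some invertible upper triangular matrix `M`: in the `p` variables, `τ_n` is the bosonic
image of the fermion
`r_0(n) · M(β_1)/M_{n-1,n-1} ∧ M(β_2)/M_{n-2,n-2} ∧ ⋯` of charge `n`,
with `β_k = exp (∑_i q_i z^i / i) z^{n-k}` and `r_0(n) = diagFactor M n`. -/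
def IsUpperTriangularTodaTau {K : Type*} [Field K] [CharZero K]
    (τ : ℤ → MvPowerSeries (ℕ+ ⊕ ℕ+) K) : Prop :=
  ∃ M : ℤ → ℤ → K, (∀ i k : ℤ, i < k → M i k = 0) ∧ (∀ k : ℤ, M k k ≠ 0) ∧
    ∀ n : ℤ, ∃ c : YoungDiagram → MvPowerSeries ℕ+ K,
      IsWedge n
        (fun j : ℕ =>
          (MvPowerSeries.C (M (n - (j + 1)) (n - (j + 1)))⁻¹ : MvPowerSeries ℕ+ K) •
            upperAct (fun i k => MvPowerSeries.C (M i k)) (todaBeta K n (j + 1))) c ∧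
      asSeriesInP (τ n) =
        MvPowerSeries.C (MvPowerSeries.C (diagFactor M n)) * bosonSeries c

/-! ### Change of scalars and constant terms of Schur polynomials. -/

section SchurPolynomials

/-! A diagonal matrix $M$ suffices. Let $d_0=1$, $d_k=y_kd_{k-1}$ and $M=\mathrm{diag}(d_k)$. With
$m_i=\mu_i-i+n$, the minor of the normalized vectors $M(\beta_j)/d_{n-j}$ that gives the coordinate
at $\mu$ has entries $d_{m_i}\,s_{\mu_i-i+j}(q)\,d_{n-j}^{-1}$. Pulling the $d$'s out of rows and
columns leaves the Jacobi–Trudi determinant $s_\mu(q)$, and the quotients $d_{m_i}/d_{n-i}$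
telescope row by row to $r_\mu(n)$. Thus the wedge has coordinates $r_\mu(n)s_\mu(q)$
(`isWedge_todaBeta`), and its bosonic image is $\tau_n/r_0(n)$ (`asSeriesInP_contentTau`).

The prefactors agree because $R_n$ and $r_0(n)$ both equal $1$ at $n=0$ and are multiplied by $d_n$
when $n$ becomes $n+1$ (`diagFactor_diagonalMatrix`); this is part (2). For part (1), multiplication
by $z^{-n}$ moves the wedge to charge $0$, the factor $r_0(n)$ is absorbed in the first vector, and
the constant term of $\tau_n$ is $r_0(n)\ne0$. The symmetry of $\tau_n$ in $p$ and $q$ gives the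
statement in $q$. -/

theorem constantCoeff_powerSumSeries (R : Type*) [CommRing R] [Algebra ℚ R] :
    PowerSeries.constantCoeff (powerSumSeries R) = 0 := by
  rw [← PowerSeries.coeff_zero_eq_constantCoeff_apply, powerSumSeries, PowerSeries.coeff_mk]
  simp

theorem hasSubst_powerSumSeries (R : Type*) [CommRing R] [Algebra ℚ R] :
    PowerSeries.HasSubst (powerSumSeries R) :=
  PowerSeries.HasSubst.of_constantCoeff_zero (constantCoeff_powerSumSeries R)

theorem map_powerSumSeries {R S : Type*} [CommRing R] [CommRing S] [Algebra ℚ R] [Algebra ℚ S]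
    (φ : R →+* S) :
    PowerSeries.map (MvPolynomial.map φ) (powerSumSeries R) = powerSumSeries S := by
  ext1 i
  rw [PowerSeries.coeff_map, powerSumSeries, powerSumSeries, PowerSeries.coeff_mk,
    PowerSeries.coeff_mk]
  split_ifs with h
  · rw [map_mul, MvPolynomial.map_C, MvPolynomial.map_X]
    congr 2
    exact RingHom.congr_fun (RingHom.ext_rat (φ.comp (algebraMap ℚ R)) (algebraMap ℚ S)) _
  · exact map_zero _

theorem map_onePartSchurSeries {R S : Type*} [CommRing R] [CommRing S] [Algebra ℚ R]
    [Algebra ℚ S] (φ : R →+* S) :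
    PowerSeries.map (MvPolynomial.map φ) (onePartSchurSeries R) = onePartSchurSeries S := by
  have h := PowerSeries.map_subst (h := MvPolynomial.map (σ := ℕ+) φ)
    (hasSubst_powerSumSeries R) (PowerSeries.exp (MvPolynomial ℕ+ R))
  rw [PowerSeries.map_exp] at h
  rw [onePartSchurSeries, onePartSchurSeries, ← map_powerSumSeries φ]
  exact h

theorem map_onePartSchur {R S : Type*} [CommRing R] [CommRing S] [Algebra ℚ R]
    [Algebra ℚ S] (φ : R →+* S) (k : ℤ) :
    MvPolynomial.map φ (onePartSchur R k) = onePartSchur S k := by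
  rw [onePartSchur, onePartSchur]
  split_ifs
  · rw [← map_onePartSchurSeries φ, PowerSeries.coeff_map]
  · exact map_zero _

/-- Needed because $s_\mu(p)$ has coefficients in $K$ in `contentTau`, but in $K[[q]]$ once the
series is read as a boson in $p$. -/
theorem map_schurPoly {R S : Type*} [CommRing R] [CommRing S] [Algebra ℚ R]
    [Algebra ℚ S] (φ : R →+* S) (μ : YoungDiagram) :
    MvPolynomial.map φ (schurPoly R μ) = schurPoly S μ := by
  rw [schurPoly, schurPoly, RingHom.map_det]
  congr 1
  ext1 i j
  exact map_onePartSchur φ _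

theorem onePartSchur_of_neg (R : Type*) [CommRing R] [Algebra ℚ R] {k : ℤ} (hk : k < 0) :
    onePartSchur R k = 0 :=
  if_neg (not_le.mpr hk)

theorem onePartSchur_zero (R : Type*) [CommRing R] [Algebra ℚ R] : onePartSchur R 0 = 1 := by
  rw [onePartSchur, if_pos le_rfl, onePartSchurSeries]
  rw [PowerSeries.coeff_subst' (hasSubst_powerSumSeries R), finsum_eq_single _ 0]
  · simp
  · intro d hd
    rw [Int.toNat_zero, PowerSeries.coeff_zero_eq_constantCoeff_apply, map_pow,
      constantCoeff_powerSumSeries, zero_pow hd, smul_zero]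

theorem schurPoly_bot (R : Type*) [CommRing R] [Algebra ℚ R] : schurPoly R ⊥ = 1 := by
  have : (⊥ : YoungDiagram).colLen 0 = 0 := by
    rw [YoungDiagram.colLen_eq_card]
    simp [YoungDiagram.col]
  rw [schurPoly]
  have : IsEmpty (Fin ((⊥ : YoungDiagram).colLen 0)) := by rw [this]; infer_instance
  exact Matrix.det_isEmpty

theorem coeff_zero_schurPoly (R : Type*) [CommRing R] [Algebra ℚ R] {μ : YoungDiagram}
    (hμ : μ ≠ ⊥) : MvPolynomial.coeff 0 (schurPoly R μ) = 0 := by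
  by_contra h
  have h1 := isWeightedHomogeneous_schurPoly R μ h
  rw [map_zero] at h1
  refine hμ (YoungDiagram.ext ?_)
  rw [YoungDiagram.cells_bot]
  exact Finset.card_eq_zero.mp h1.symm

end SchurPolynomials

/-! ### Jacobi–Trudi determinants and products over cells. -/

section Determinants

theorem YoungDiagram.rowLen_eq_zero (μ : YoungDiagram) {i : ℕ} (h : μ.colLen 0 ≤ i) :
    μ.rowLen i = 0 := by
  by_contra h0
  exact absurd (YoungDiagram.mem_iff_lt_colLen.mp
    (YoungDiagram.mem_iff_lt_rowLen.mpr (Nat.pos_of_ne_zero h0))) (not_lt.mpr h)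

/-- The Jacobi–Trudi determinant does not change when empty rows are added to the diagram. -/
theorem det_jacobiTrudi_eq {R : Type*} [CommRing R] (u : ℤ → R) (hneg : ∀ k < 0, u k = 0)
    (h0 : u 0 = 1) (μ : YoungDiagram) {N : ℕ} (hN : μ.colLen 0 ≤ N) :
    Matrix.det (Matrix.of fun i j : Fin N => u ((μ.rowLen i : ℤ) - (i : ℕ) + (j : ℕ))) =
      Matrix.det (Matrix.of fun i j : Fin (μ.colLen 0) =>
        u ((μ.rowLen j : ℤ) - (j : ℕ) + (i : ℕ))) := by
  induction N, hN using Nat.le_induction with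
  | base =>
    rw [← Matrix.det_transpose]
    rfl
  | succ N hN ih =>
    -- The added row is empty, so its entries are $u_{j-N}$: zero for $j<N$ and $1$ on the diagonal.
    rw [← ih, Matrix.det_succ_row _ (Fin.last N), Finset.sum_eq_single (Fin.last N)]
    · have : (Matrix.of fun i j : Fin (N + 1) => u ((μ.rowLen i : ℤ) - (i : ℕ) + (j : ℕ)))
          (Fin.last N) (Fin.last N) = 1 := by
        simp [μ.rowLen_eq_zero hN, h0]
      rw [this, Even.neg_one_pow (by simp), one_mul, one_mul]
      congr 1
      ext1 i j
      simp
    · intro j _ hj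
      have hj' : (j : ℕ) < N := by
        have := Fin.val_lt_last hj
        simpa using this
      have : (Matrix.of fun i j : Fin (N + 1) => u ((μ.rowLen i : ℤ) - (i : ℕ) + (j : ℕ)))
          (Fin.last N) j = 0 := by
        simp only [Matrix.of_apply, Fin.val_last, μ.rowLen_eq_zero hN]
        exact hneg _ (by omega)
      rw [this, mul_zero, zero_mul]
    · simp

theorem YoungDiagram.prod_cells_eq {M : Type*} [CommMonoid M] (μ : YoungDiagram)
    (f : ℕ × ℕ → M) {N : ℕ} (hN : μ.colLen 0 ≤ N) :
    ∏ w ∈ μ.cells, f w = ∏ i ∈ Finset.range N, ∏ j ∈ Finset.range (μ.rowLen i), f (i, j) := by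
  rw [Finset.prod_sigma']
  refine Finset.prod_bij' (fun w _ => ⟨w.1, w.2⟩) (fun w _ => (w.1, w.2)) ?_ ?_ ?_ ?_ ?_
  · intro w hw
    have hw' : (w.1, w.2) ∈ μ := (YoungDiagram.mem_cells w).mp hw
    rw [Finset.mem_sigma, Finset.mem_range, Finset.mem_range]
    refine ⟨lt_of_lt_of_le (YoungDiagram.mem_iff_lt_colLen.mp
      (μ.up_left_mem le_rfl (Nat.zero_le _) hw')) hN, YoungDiagram.mem_iff_lt_rowLen.mp hw'⟩
  · intro w hw
    rw [Finset.mem_sigma, Finset.mem_range, Finset.mem_range] at hw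
    exact (YoungDiagram.mem_cells _).mpr (YoungDiagram.mem_iff_lt_rowLen.mpr hw.2)
  all_goals intros; rfl

end Determinants

/-! ### The diagonal matrix and the normalizing factors. -/

section Diagonal

variable {K : Type*} [Field K]

/-- A solution of `d_k = y_k d_{k-1}` with `d_0 = 1`. -/
noncomputable def integralProd (y : ℤ → K) (k : ℤ) : K :=
  if 0 ≤ k then ∏ j ∈ Finset.Icc 1 k, y j else ∏ j ∈ Finset.Icc (k + 1) 0, (y j)⁻¹

theorem integralProd_ne_zero {y : ℤ → K} (hy : ∀ i, y i ≠ 0) (k : ℤ) :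
    integralProd y k ≠ 0 := by
  rw [integralProd]
  split_ifs
  · exact Finset.prod_ne_zero_iff.mpr fun i _ => hy i
  · exact Finset.prod_ne_zero_iff.mpr fun i _ => inv_ne_zero (hy i)

theorem integralProd_succ {y : ℤ → K} (hy : ∀ i, y i ≠ 0) (k : ℤ) :
    integralProd y (k + 1) = integralProd y k * y (k + 1) := by
  rw [integralProd, integralProd]
  rcases lt_trichotomy k (-1) with h | rfl | h
  · rw [if_neg (by omega), if_neg (by omega),
      show Finset.Icc (k + 1) 0 = insert (k + 1) (Finset.Icc (k + 1 + 1) 0) by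
        ext x; simp only [Finset.mem_insert, Finset.mem_Icc]; omega,
      Finset.prod_insert (by simp), mul_comm, mul_inv_cancel_left₀ (hy _)]
  · simp [hy]
  · rw [if_pos (by omega), if_pos (by omega),
      show Finset.Icc 1 (k + 1) = insert (k + 1) (Finset.Icc 1 k) by
        ext x; simp only [Finset.mem_insert, Finset.mem_Icc]; omega,
      Finset.prod_insert (by simp), mul_comm]

theorem integralProd_add_nat {y : ℤ → K} (hy : ∀ i, y i ≠ 0) (k : ℤ) (m : ℕ) :
    integralProd y (k + m) = integralProd y k * ∏ j ∈ Finset.range m, y (k + 1 + j) := by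
  induction m with
  | zero => simp
  | succ m ih =>
    rw [Finset.prod_range_succ, ← mul_assoc, ← ih, Nat.cast_succ, ← add_assoc,
      integralProd_succ hy, add_right_comm k 1]

/-- Row by row, the recurrence telescopes $d_{n-i-1+\mu_i}/d_{n-i-1}$ to $\prod_{j<\mu_i}y_{n-i+j}$,
and $j-i$ is the content of the cell $(i,j)$. Rows beyond the diagram contribute $1$. -/
theorem prod_integralProd_eq_contentProd {y : ℤ → K} (hy : ∀ i, y i ≠ 0) (μ : YoungDiagram)
    (n : ℤ) {N : ℕ} (hN : μ.colLen 0 ≤ N) :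
    (∏ i : Fin N, integralProd y ((μ.rowLen i : ℤ) - ((i : ℕ) + 1) + n)) *
      ∏ i : Fin N, (integralProd y (n - ((i : ℕ) + 1)))⁻¹ = contentProd y μ n := by
  rw [contentProd, μ.prod_cells_eq _ hN, ← Finset.prod_mul_distrib,
    Fin.prod_univ_eq_prod_range (fun i : ℕ => integralProd y ((μ.rowLen i : ℤ) - (i + 1) + n) *
      (integralProd y (n - (i + 1)))⁻¹) N]
  refine Finset.prod_congr rfl fun i _ => ?_
  rw [show (μ.rowLen i : ℤ) - (i + 1) + n = n - (i + 1) + (μ.rowLen i : ℕ) by ring,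
    integralProd_add_nat hy, mul_comm, inv_mul_cancel_left₀ (integralProd_ne_zero hy _)]
  refine Finset.prod_congr rfl fun j _ => ?_
  congr 1
  ring

theorem normFactor_ne_zero {y : ℤ → K} (hy : ∀ i, y i ≠ 0) (n : ℤ) : normFactor y n ≠ 0 := by
  rw [normFactor]
  split_ifs <;> exact Finset.prod_ne_zero_iff.mpr fun i _ => pow_ne_zero _ (hy i)

theorem normFactor_succ {y : ℤ → K} (hy : ∀ i, y i ≠ 0) (n : ℤ) :
    normFactor y (n + 1) = normFactor y n * integralProd y n := by
  -- The case $n=-1$ stands apart: there $n$ and $n+1$ fall in different branches of the definition.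
  rcases lt_trichotomy n (-1) with h | rfl | h
  · rw [normFactor, normFactor, integralProd, if_neg (by omega), if_neg (by omega),
      if_neg (by omega),
      show Finset.Icc (n + 1) 0 = insert (n + 1) (Finset.Icc (n + 1 + 1) 0) by
        ext x; simp only [Finset.mem_insert, Finset.mem_Icc]; omega,
      Finset.prod_insert (by simp), Finset.prod_insert (by simp),
      show (n + 1 - n).toNat = 1 by omega, pow_one, mul_mul_mul_comm, mul_inv_cancel₀ (hy _),
      one_mul, ← Finset.prod_mul_distrib]
    refine Finset.prod_congr rfl fun j hj => ?_
    rw [Finset.mem_Icc] at hj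
    rw [show (j - n).toNat = (j - (n + 1)).toNat + 1 by omega, pow_succ,
      mul_inv_cancel_right₀ (hy _)]
  · simp [normFactor, integralProd, hy]
  · rw [normFactor, normFactor, integralProd, if_pos (by omega), if_pos (by omega),
      if_pos (by omega), add_sub_cancel_right]
    rcases eq_or_lt_of_le (show 0 ≤ n by omega) with rfl | hn
    · simp
    rw [show Finset.Icc 1 n = insert n (Finset.Icc 1 (n - 1)) by
        ext x; simp only [Finset.mem_insert, Finset.mem_Icc]; omega,
      Finset.prod_insert (by simp), Finset.prod_insert (by simp),
      show (n + 1 - n).toNat = 1 by omega, pow_one, mul_left_comm, ← Finset.prod_mul_distrib]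
    congr 1
    refine Finset.prod_congr rfl fun j hj => ?_
    rw [Finset.mem_Icc] at hj
    rw [show (n + 1 - j).toNat = (n - j).toNat + 1 by omega, pow_succ]

theorem diagFactor_succ {M : ℤ → ℤ → K} (hM : ∀ k, M k k ≠ 0) (n : ℤ) :
    diagFactor M (n + 1) = diagFactor M n * M n n := by
  rw [diagFactor, diagFactor]
  rcases lt_trichotomy n (-1) with h | rfl | h
  · rw [if_neg (by omega), if_neg (by omega),
      show Finset.Ico n 0 = insert n (Finset.Ico (n + 1) 0) by
        ext x; simp only [Finset.mem_insert, Finset.mem_Ico]; omega,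
      Finset.prod_insert (by simp), mul_comm, mul_inv_cancel_left₀ (hM _)]
  · simp [hM, show Finset.Ico (-1 : ℤ) 0 = {-1} from rfl]
  · rw [if_pos (by omega), if_pos (by omega),
      show Finset.Ico 0 (n + 1) = insert n (Finset.Ico 0 n) by
        ext x; simp only [Finset.mem_insert, Finset.mem_Ico]; omega,
      Finset.prod_insert (by simp), mul_comm]

/-- The diagonal matrix with the entries `d_k`. -/
noncomputable def diagonalMatrix (y : ℤ → K) (i k : ℤ) : K :=
  if i = k then integralProd y k else 0

theorem diagonalMatrix_self (y : ℤ → K) (k : ℤ) : diagonalMatrix y k k = integralProd y k :=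
  if_pos rfl

theorem diagFactor_diagonalMatrix {y : ℤ → K} (hy : ∀ i, y i ≠ 0) (n : ℤ) :
    diagFactor (diagonalMatrix y) n = normFactor y n := by
  have hM : ∀ k, diagonalMatrix y k k ≠ 0 := fun k => by
    rw [diagonalMatrix_self]; exact integralProd_ne_zero hy k
  -- Since $d_k\ne0$, the common recurrence can be run in both directions from $0$.
  have step : ∀ k, diagFactor (diagonalMatrix y) (k + 1) = normFactor y (k + 1) ↔
      diagFactor (diagonalMatrix y) k = normFactor y k := fun k => by
    rw [diagFactor_succ hM, normFactor_succ hy, diagonalMatrix_self,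
      mul_left_inj' (integralProd_ne_zero hy k)]
  induction n with
  | zero => simp [diagFactor, normFactor]
  | succ i ih => exact (step _).mpr ih
  | pred i ih => exact (step _).mp (by rwa [sub_add_cancel])

end Diagonal

/-! ### Operations on wedges and on their bosonic images. -/

section Wedge

variable {R : Type*} [CommRing R]

/-- Every nonempty minor is linear in its first column, and admissibility only concerns large
indices. -/
theorem IsWedge.smul_zero {n : ℤ} {β : ℕ → LaurentSeries R} {c : YoungDiagram → R}
    (h : IsWedge n β c) (r : R) :
    IsWedge n (Function.update β 0 (r • β 0)) (fun μ => r * c μ) := by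
  refine ⟨?_, fun μ => ?_⟩
  · filter_upwards [h.1, Filter.eventually_gt_atTop 0] with j hj h0
    rwa [Function.update_of_ne h0.ne']
  · filter_upwards [h.2 μ, Filter.eventually_gt_atTop 0] with N hN h0
    obtain ⟨N, rfl⟩ := Nat.exists_eq_succ_of_ne_zero h0.ne'
    rw [← hN]
    have := Matrix.det_mul_row (fun j : Fin (N + 1) => if j = 0 then r else 1)
      (Matrix.of fun i j : Fin (N + 1) =>
        (β j).coeff ((μ.rowLen i : ℤ) - ((i : ℕ) + 1) + n))
    rw [Finset.prod_ite_eq' Finset.univ (0 : Fin (N + 1)) fun _ => r,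
      if_pos (Finset.mem_univ _)] at this
    rw [← this]
    congr 1
    ext1 i j
    simp only [Matrix.of_apply]
    by_cases hj : j = 0
    · subst hj
      rw [if_pos rfl, Fin.val_zero, Function.update_self, HahnSeries.coeff_smul, smul_eq_mul]
    · rw [if_neg hj, one_mul, Function.update_of_ne]
      exact fun h => hj (Fin.ext h)

/-- Multiplication by $z^{-n}$ shifts all exponents at once, so the minors are literally the same.
-/
theorem IsWedge.shift {n : ℤ} {β : ℕ → LaurentSeries R} {c : YoungDiagram → R}
    (h : IsWedge n β c) :
    IsWedge 0 (fun j => HahnSeries.single (-n) 1 * β j) c := by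
  refine ⟨?_, fun μ => ?_⟩
  · filter_upwards [h.1] with j hj
    simp only [HahnSeries.coeff_single_mul, one_mul, sub_neg_eq_add]
    refine ⟨?_, fun m hm => hj.2 _ (by omega)⟩
    rw [← hj.1]
    congr 1
    ring
  · filter_upwards [h.2 μ] with N hN
    simp only [HahnSeries.coeff_single_mul, one_mul, sub_neg_eq_add, add_zero]
    exact hN

theorem coeff_upperAct_diagonal (M : ℤ → ℤ → R) (hM : ∀ i k, i ≠ k → M i k = 0)
    (f : LaurentSeries R) (i : ℤ) : (upperAct M f).coeff i = M i i * f.coeff i := by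
  change ∑ k ∈ Finset.Icc f.order i, M i k * f.coeff k = _
  by_cases hi : f.order ≤ i
  · rw [Finset.sum_eq_single i]
    · intro k _ hk
      rw [hM i k hk.symm, zero_mul]
    · intro h
      exact absurd (Finset.mem_Icc.mpr ⟨hi, le_rfl⟩) h
  · rw [Finset.Icc_eq_empty hi, Finset.sum_empty,
      HahnSeries.coeff_eq_zero_of_lt_order (not_le.mp hi), mul_zero]

theorem coeff_bosonSeries [Algebra ℚ R] (c : YoungDiagram → R) (e : ℕ+ →₀ ℕ) :
    MvPowerSeries.coeff e (bosonSeries c) =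
      ∑ᶠ μ, c μ * MvPolynomial.coeff e (schurPoly R μ) := by
  refine finsum_congr fun μ => ?_
  change MvPowerSeries.coeff e (MvPowerSeries.C (c μ) * _) = _
  rw [MvPowerSeries.coeff_C_mul, MvPolynomial.coeff_coe]

theorem finite_support_coeff_schurPoly [Algebra ℚ R] (c : YoungDiagram → R) (e : ℕ+ →₀ ℕ) :
    (Function.support fun μ => c μ * MvPolynomial.coeff e (schurPoly R μ)).Finite := by
  refine (finite_schur_terms c e).subset fun μ hμ => ?_
  rwa [Set.mem_ofPred_eq, MvPowerSeries.coeff_C_mul, MvPolynomial.coeff_coe]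

theorem bosonSeries_mul [Algebra ℚ R] (r : R) (c : YoungDiagram → R) :
    bosonSeries (fun μ => r * c μ) = MvPowerSeries.C r * bosonSeries c := by
  ext e
  rw [MvPowerSeries.coeff_C_mul, coeff_bosonSeries, coeff_bosonSeries,
    mul_finsum' _ _ (finite_support_coeff_schurPoly c e)]
  exact finsum_congr fun μ => mul_assoc _ _ _

end Wedge

/-! ### Coefficients of the vectors $\beta_k$ and of products in separate variables. -/

theorem coeff_todaBeta (K : Type*) [Field K] [CharZero K] (n k m : ℤ) :
    (todaBeta K n k).coeff m =
      ((onePartSchur K (m - (n - k)) : MvPolynomial ℕ+ K) : MvPowerSeries ℕ+ K) := by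
  rw [todaBeta, HahnSeries.coeff_single_mul, one_mul, onePartSchur]
  split_ifs with h
  · obtain ⟨a, ha⟩ := Int.eq_ofNat_of_zero_le h
    rw [ha, HahnSeries.ofPowerSeries_apply_coeff, PowerSeries.coeff_map, Int.toNat_natCast]
    rfl
  · rw [PowerSeries.coeff_coe, if_pos (not_le.mp h), MvPolynomial.coe_zero]

theorem coeff_sumElim_rename_mul_rename {σ τ R : Type*} [CommRing R] (f : MvPolynomial σ R)
    (g : MvPolynomial τ R) (a : σ →₀ ℕ) (b : τ →₀ ℕ) :
    MvPolynomial.coeff (Finsupp.sumElim a b)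
      (MvPolynomial.rename Sum.inl f * MvPolynomial.rename Sum.inr g) =
      MvPolynomial.coeff a f * MvPolynomial.coeff b g := by
  classical
  induction f using MvPolynomial.induction_on' with
  | add p q hp hq => simp only [map_add, add_mul, MvPolynomial.coeff_add, hp, hq]
  | monomial u r =>
    induction g using MvPolynomial.induction_on' with
    | add p q hp hq => simp only [map_add, mul_add, MvPolynomial.coeff_add, hp, hq]
    | monomial v s =>
      rw [MvPolynomial.rename_monomial, MvPolynomial.rename_monomial,
        MvPolynomial.monomial_mul, MvPolynomial.coeff_monomial, MvPolynomial.coeff_monomial,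
        MvPolynomial.coeff_monomial]
      have : Finsupp.mapDomain Sum.inl u + Finsupp.mapDomain Sum.inr v = Finsupp.sumElim a b ↔
          u = a ∧ v = b := by
        have hl : ∀ x, Finsupp.mapDomain (Sum.inr : τ → σ ⊕ τ) v (Sum.inl x) = 0 := fun x =>
          Finsupp.mapDomain_of_notMem_range _ _ (by simp)
        have hr : ∀ x, Finsupp.mapDomain (Sum.inl : σ → σ ⊕ τ) u (Sum.inr x) = 0 := fun x =>
          Finsupp.mapDomain_of_notMem_range _ _ (by simp)
        simp only [DFunLike.ext_iff, Sum.forall, Finsupp.add_apply, hl, hr,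
          Finsupp.mapDomain_apply Sum.inl_injective, Finsupp.mapDomain_apply Sum.inr_injective,
          Finsupp.sumElim_inl, Finsupp.sumElim_inr, add_zero, zero_add]
      simp only [this]
      by_cases h1 : u = a <;> by_cases h2 : v = b <;> simp [h1, h2]

/-! ### The series $\tau_n$ as bosonic images. -/

section ContentTau

variable {K : Type*} [Field K] [CharZero K]

theorem coeff_contentTau (y : ℤ → K) (n : ℤ) (a b : ℕ+ →₀ ℕ) :
    MvPowerSeries.coeff (Finsupp.sumElim a b) (contentTau y n) =
      normFactor y n * ∑ᶠ μ, contentProd y μ n *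
        (MvPolynomial.coeff a (schurPoly K μ) * MvPolynomial.coeff b (schurPoly K μ)) := by
  rw [contentTau, MvPowerSeries.coeff_C_mul]
  congr 1
  refine finsum_congr fun μ => ?_
  beta_reduce
  rw [mul_assoc, MvPowerSeries.coeff_C_mul, ← MvPolynomial.coe_mul, MvPolynomial.coeff_coe,
    coeff_sumElim_rename_mul_rename]

theorem asSeriesInQ_contentTau (y : ℤ → K) (n : ℤ) :
    asSeriesInQ (contentTau y n) = asSeriesInP (contentTau y n) := by
  funext b a
  change MvPowerSeries.coeff _ _ = MvPowerSeries.coeff _ _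
  rw [coeff_contentTau, coeff_contentTau]
  congr 1
  exact finsum_congr fun μ => by ring

theorem asSeriesInP_contentTau_ne_zero {y : ℤ → K} (hy : ∀ i, y i ≠ 0) (n : ℤ) :
    asSeriesInP (contentTau y n) ≠ 0 := by
  intro h
  have h0 : MvPowerSeries.coeff (Finsupp.sumElim 0 0) (contentTau y n) = 0 :=
    congrFun (congrFun h 0) 0
  -- Only the empty partition contributes to the constant term, which is therefore $r_0(n)$.
  rw [coeff_contentTau, finsum_eq_single _ ⊥ fun μ hμ => by
    rw [coeff_zero_schurPoly K hμ, zero_mul, mul_zero]] at h0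
  simp [schurPoly_bot, contentProd, normFactor_ne_zero hy] at h0

theorem asSeriesInP_contentTau (y : ℤ → K) (n : ℤ) :
    asSeriesInP (contentTau y n) =
      MvPowerSeries.C (MvPowerSeries.C (normFactor y n)) * bosonSeries fun μ =>
        MvPowerSeries.C (contentProd y μ n) * (schurPoly K μ : MvPowerSeries ℕ+ K) := by
  ext a b
  rw [MvPowerSeries.coeff_C_mul, MvPowerSeries.coeff_C_mul, coeff_bosonSeries]
  change MvPowerSeries.coeff (Finsupp.sumElim a b) (contentTau y n) = _
  rw [coeff_contentTau]
  -- Taking the coefficient at $q^b$ commutes with the sum over $\mu$ because, for fixed $a$, only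
  -- finitely many $s_\mu(p)$ contain $p^a$.
  refine congrArg (normFactor y n * ·) (Eq.trans ?_ (AddMonoidHom.map_finsum
    (MvPowerSeries.coeff b : MvPowerSeries ℕ+ K →ₗ[K] K).toAddMonoidHom
    (finite_support_coeff_schurPoly _ a)).symm)
  refine finsum_congr fun μ => ?_
  rw [LinearMap.toAddMonoidHom_coe,
    ← map_schurPoly (MvPowerSeries.C : K →+* MvPowerSeries ℕ+ K), MvPolynomial.coeff_map,
    mul_assoc, MvPowerSeries.coeff_C_mul, MvPowerSeries.coeff_mul_C, MvPolynomial.coeff_coe,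
    mul_comm (MvPolynomial.coeff b _)]

theorem isWedge_todaBeta {y : ℤ → K} (hy : ∀ i, y i ≠ 0) (n : ℤ) :
    IsWedge n
      (fun j : ℕ =>
        (MvPowerSeries.C (diagonalMatrix y (n - (j + 1)) (n - (j + 1)))⁻¹ :
          MvPowerSeries ℕ+ K) •
          upperAct (fun i k => MvPowerSeries.C (diagonalMatrix y i k)) (todaBeta K n (j + 1)))
      fun μ => MvPowerSeries.C (contentProd y μ n) * (schurPoly K μ : MvPowerSeries ℕ+ K) := by
  have hcoeff : ∀ (j : ℕ) (m : ℤ),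
      ((MvPowerSeries.C (diagonalMatrix y (n - (j + 1)) (n - (j + 1)))⁻¹ :
          MvPowerSeries ℕ+ K) •
        upperAct (fun i k => MvPowerSeries.C (diagonalMatrix y i k))
          (todaBeta K n (j + 1))).coeff m =
      MvPowerSeries.C (integralProd y (n - (j + 1)))⁻¹ * (MvPowerSeries.C (integralProd y m) *
        ((onePartSchur K (m - (n - (j + 1))) : MvPolynomial ℕ+ K) : MvPowerSeries ℕ+ K)) := by
    intro j m
    rw [HahnSeries.coeff_smul, smul_eq_mul, coeff_upperAct_diagonal, coeff_todaBeta,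
      diagonalMatrix_self, diagonalMatrix_self]
    intro i k hik
    rw [diagonalMatrix, if_neg hik, map_zero]
  refine ⟨Filter.Eventually.of_forall fun j => ⟨?_, fun m hm => ?_⟩, fun μ => ?_⟩
  · rw [hcoeff, sub_self, onePartSchur_zero, MvPolynomial.coe_one, mul_one, ← map_mul,
      inv_mul_cancel₀ (integralProd_ne_zero hy _), map_one]
  · rw [hcoeff, onePartSchur_of_neg K (by omega), MvPolynomial.coe_zero, mul_zero, mul_zero]
  · filter_upwards [Filter.eventually_ge_atTop (μ.colLen 0)] with N hN
    simp only [hcoeff]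
    -- The right side is also written as an $N\times N$ determinant: one product of $d$'s scales the
    -- rows, the product of inverses scales the columns, and the Jacobi–Trudi matrix is padded to
    -- size $N$. The two matrices then agree entrywise.
    rw [← prod_integralProd_eq_contentProd hy μ n hN, map_mul, map_prod, map_prod, schurPoly,
      ← det_jacobiTrudi_eq (onePartSchur K) (fun _ => onePartSchur_of_neg K)
        (onePartSchur_zero K) μ hN,
      ← MvPolynomial.coeToMvPowerSeries.ringHom_apply, RingHom.map_det,
      mul_comm (Finset.prod _ _), mul_assoc, ← Matrix.det_mul_column, ← Matrix.det_mul_row]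
    congr 1
    ext1 i j
    simp only [Matrix.of_apply, RingHom.mapMatrix_apply, Matrix.map_apply,
      MvPolynomial.coeToMvPowerSeries.ringHom_apply]
    congr 4
    ring

theorem isKPTau_contentTau {y : ℤ → K} (hy : ∀ i, y i ≠ 0) (n : ℤ) :
    IsKPTau (asSeriesInP (contentTau y n)) :=
  ⟨asSeriesInP_contentTau_ne_zero hy n, _, _,
    (isWedge_todaBeta hy n).shift.smul_zero (MvPowerSeries.C (normFactor y n)), by
      rw [bosonSeries_mul, asSeriesInP_contentTau]⟩

theorem isUpperTriangularTodaTau_contentTau {y : ℤ → K} (hy : ∀ i, y i ≠ 0) :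
    IsUpperTriangularTodaTau (contentTau y) := by
  refine ⟨diagonalMatrix y, fun i k hik => if_neg hik.ne, fun k => ?_, fun n =>
    ⟨_, isWedge_todaBeta hy n, ?_⟩⟩
  · rw [diagonalMatrix_self]
    exact integralProd_ne_zero hy k
  · rw [diagFactor_diagonalMatrix hy, asSeriesInP_contentTau]

end ContentTau

/-- The elements `y i` may be independent formal parameters, in the field of rational functions
in them; no relation between them is assumed. -/
theorem theorem2p17 {K : Type*} [Field K] [CharZero K] (y : ℤ → K) (hy : ∀ i : ℤ, y i ≠ 0) :
    (∀ n : ℤ, IsKPTau (asSeriesInP (contentTau y n)) ∧ IsKPTau (asSeriesInQ (contentTau y n))) ∧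
      IsUpperTriangularTodaTau (contentTau y) :=
  ⟨fun n => ⟨isKPTau_contentTau hy n, by
    rw [asSeriesInQ_contentTau]; exact isKPTau_contentTau hy n⟩,
    isUpperTriangularTodaTau_contentTau hy⟩
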